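/- Let $\mathcal C$ be an abelian category and let $(\mathcal T,\mathcal F)$ be a torsion pair in $\mathcal C$, i.e. $\mathcal T,\mathcal F$ are full subcategories (closed under isomorphism) with $\operatorname{Hom}(T,F)=0$ for all $T\in\mathcal T$, $F\in\mathcal F$, and every object $X$ of $\mathcal C$ fits into a short exact sequence $0\to T\to X\to F\to 0$ with $T\in\mathcal T$, $F\in\mathcal F$. Let ${}^p\mathcal C$ be the tilt of $\mathcal C$ with respect to $(\mathcal T,\mathcal F)$, i.e. the (abelian) heart of the $t$-structure on $D^b(\mathcal C)$ given by $${}^pD^{b}(\mathcal C)^{\le 0}=\{X : H^i(X)=0 \text{ for } i>1,\ H^1(X)\in\mathcal T\},\qquad {}^pD^{b}(\mathcal C)^{\ge 0}=\{X : H^i(X)=0 \text{ for } i<0,\ H^0(X)\in\mathcal F\}.$$ Note that $\mathcal F$, placed in degree $0$, is a full subcategory of ${}^p\mathcal C$. Assume that $(\mathcal T,\mathcal F)$ is cotilting, i.e. every object of $\mathcal C$ is a quotient of an object of $\mathcal F$. Then there is an equivalence of triangulated categories $$\Phi: D({}^p\mathcal C)\xrightarrow{\ \sim\ } D(\mathcal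 C)$$ between the unbounded derived categories, which is the identity on complexes over $\mathcal F$: if a complex $K$ over $\mathcal F$ is regarded as a complex over ${}^p\mathcal C$ and as a complex over $\mathcal C$, then $\Phi(K)\cong K$, naturally in $K$. Moreover $\Phi$ restricts to an equivalence of triangulated categories $D^b({}^p\mathcal C)\xrightarrow{\sim} D^b(\mathcal C)$ between the bounded derived categories. -/

import Mathlib

open CategoryTheory Limits Pretriangulated Triangulated ZeroObject

universe w' w v u

namespace CategoryTheory.Triangulated.TStructure

section HeartAbelian

variable {D : Type*} [Category* D] [Preadditive D] [HasZeroObject D] [HasShift D ℤ]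
  [∀ n : ℤ, (shiftFunctor D n).Additive] [Pretriangulated D] (t : TStructure D)

lemma heart_hom_shift_eq_zero ⦃X Y : t.heart.FullSubcategory⦄ ⦃n : ℤ⦄
    (f : t.heart.ι.obj X ⟶ (t.heart.ι.obj Y)⟦n⟧) (hn : n < 0) : f = 0 := by
  have := ((t.mem_heart_iff _).1 X.property).1
  have := ((t.mem_heart_iff _).1 Y.property).2
  have : t.IsGE ((t.heart.ι.obj Y)⟦n⟧) (-n) := t.isGE_shift Y.obj 0 n (-n)
  exact t.zero_of_isLE_of_isGE f 0 (-n) (by lia) ‹_› this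

instance heart_containsZero : t.heart.ContainsZero :=
  ⟨0, isZero_zero D, (t.mem_heart_iff _).2 ⟨inferInstance, inferInstance⟩⟩

instance heart_isTriangulatedClosed₂ : t.heart.IsTriangulatedClosed₂ :=
  .mk' (fun T hT h₁ h₃ ↦ by
    rw [mem_heart_iff] at h₁ h₃ ⊢
    exact ⟨t.isLE₂ T hT 0 h₁.1 h₃.1, t.isGE₂ T hT 0 h₁.2 h₃.2⟩)

instance heart_hasFiniteProducts : HasFiniteProducts t.heart.FullSubcategory := by
  have : t.heart.IsClosedUnderBinaryProducts := ⟨by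
    rintro X ⟨p⟩
    have e := p.isLimit.conePointUniqueUpToIso (IsLimit.postcomposeInvEquiv (diagramIsoPair p.diag) _
      |>.symm (prodIsProd (p.diag.obj ⟨.left⟩) (p.diag.obj ⟨.right⟩)))
    exact t.heart.prop_of_iso e.symm (t.heart.ext_of_isTriangulatedClosed₂ _
      (binaryProductTriangle_distinguished _ _) (p.prop_diag_obj _) (p.prop_diag_obj _))⟩
  have : t.heart.IsClosedUnderFiniteProducts := .mk'
  exact ⟨fun n ↦ inferInstance⟩

lemma distTriang_of_iso₁ {A A' X B : D} {f : A ⟶ X} {g : X ⟶ B} {h : B ⟶ A⟦(1 : ℤ)⟧}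
    (hT : Triangle.mk f g h ∈ distTriang D) (e : A' ≅ A) :
    Triangle.mk (e.hom ≫ f) g (h ≫ e.inv⟦(1 : ℤ)⟧') ∈ distTriang D := by
  have key : (h ≫ e.inv⟦(1 : ℤ)⟧') ≫ e.hom⟦(1 : ℤ)⟧' = h := by
    rw [Category.assoc, ← Functor.map_comp, e.inv_hom_id, Functor.map_id, Category.comp_id]
  exact isomorphic_distinguished _ hT _ (Triangle.isoMk _ _ e (Iso.refl _) (Iso.refl _)
    (Category.comp_id _) ((Category.comp_id _).trans (Category.id_comp _).symm)
    (key.trans (Category.id_comp h).symm))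

lemma heart_admissibleMorphism [IsTriangulated D] :
    AbelianSubcategory.admissibleMorphism t.heart.ι = ⊤ := by
  ext X₁ X₂ f
  simp only [MorphismProperty.top_apply, iff_true]
  intro X₃ f₂ f₃ hT
  have h₁ := (t.mem_heart_iff _).1 X₁.property
  have h₂ := (t.mem_heart_iff _).1 X₂.property
  have := h₁.1; have := h₁.2; have := h₂.1; have := h₂.2
  have l₁ : t.IsLE (X₁.obj⟦(1 : ℤ)⟧) 0 := by
    have : t.IsLE (X₁.obj⟦(1 : ℤ)⟧) (-1) := t.isLE_shift X₁.obj 0 1 (-1)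
    exact t.isLE_of_le _ (-1) 0
  have g₁ : t.IsGE (X₁.obj⟦(1 : ℤ)⟧) (-1) := t.isGE_shift X₁.obj 0 1 (-1)
  have hL : t.IsLE X₃ 0 := t.isLE₂ _ (rot_of_distTriang _ hT) 0 h₂.1 l₁
  have hG : t.IsGE X₃ (-1) :=
    t.isGE₂ _ (rot_of_distTriang _ hT) (-1) (t.isGE_of_ge X₂.obj (-1) 0) g₁
  have k₁ : t.IsLE (((t.truncLE (-1)).obj X₃)⟦(-1 : ℤ)⟧) 0 := t.isLE_shift _ (-1) (-1) 0
  have k₂ : t.IsGE (((t.truncLE (-1)).obj X₃)⟦(-1 : ℤ)⟧) 0 := t.isGE_shift _ (-1) (-1) 0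
  let K : t.heart.FullSubcategory := ⟨_, (t.mem_heart_iff _).2 ⟨k₁, k₂⟩⟩
  let Q : t.heart.FullSubcategory :=
    ⟨(t.truncGE 0).obj X₃, (t.mem_heart_iff _).2 ⟨inferInstance, inferInstance⟩⟩
  let e : (t.heart.ι.obj K)⟦(1 : ℤ)⟧ ≅ (t.truncLE (-1)).obj X₃ :=
    (shiftEquiv D (1 : ℤ)).counitIso.app ((t.truncLE (-1)).obj X₃)
  exact ⟨K, Q, _, _, _, distTriang_of_iso₁
    (t.triangleLEGE_distinguished (-1) 0 (by lia) X₃) e⟩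

/-- The heart of a t-structure on a triangulated category is an abelian category. -/
noncomputable instance heart_abelian [IsTriangulated D] : Abelian t.heart.FullSubcategory :=
  AbelianSubcategory.abelian t.heart.ι t.heart_hom_shift_eq_zero t.heart_admissibleMorphism

end HeartAbelian

end CategoryTheory.Triangulated.TStructure

/-- A torsion pair `(𝒯, ℱ)` in an abelian category `C`: two full subcategories (as usual, closed
under isomorphisms), with no nonzero morphism from an object of `𝒯` to an object of `ℱ`, such that
every object `X` sits in a short exact sequence `0 ⟶ T ⟶ X ⟶ F ⟶ 0` with `T` in `𝒯` and
`F` in `ℱ`. (The vanishing of morphisms makes this sequence unique up to a unique isomorphism.) -/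
structure TorsionPair (C : Type u) [Category.{v} C] [Abelian C] where
  /-- the torsion class `𝒯` -/
  tors : ObjectProperty C
  /-- the torsion-free class `ℱ` -/
  free : ObjectProperty C
  tors_iso : tors.IsClosedUnderIsomorphisms
  free_iso : free.IsClosedUnderIsomorphisms
  hom_eq_zero ⦃T F : C⦄ (hT : tors T) (hF : free F) (f : T ⟶ F) : f = 0
  exists_shortExact (X : C) : ∃ (S : ShortComplex C) (_ : S.X₂ ≅ X),
    S.ShortExact ∧ tors S.X₁ ∧ free S.X₃

namespace TorsionPair

variable {C : Type u} [Category.{v} C] [Abelian C] (τ : TorsionPair C)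

instance : τ.tors.IsClosedUnderIsomorphisms := τ.tors_iso

instance : τ.free.IsClosedUnderIsomorphisms := τ.free_iso

/-- The torsion pair is cotilting: every object of `C` is a quotient of a torsion-free object. -/
def IsCotilting : Prop :=
  ∀ X : C, ∃ (F : C) (_ : τ.free F) (p : F ⟶ X), Epi p

lemma tors_of_isZero {X : C} (hX : IsZero X) : τ.tors X := by
  obtain ⟨S, e, hS, h₁, -⟩ := τ.exists_shortExact X
  have := hS.mono_f
  have h : IsZero S.X₁ := IsZero.of_mono S.f (hX.of_iso e)
  exact τ.tors.prop_of_iso (h.iso hX) h₁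

lemma free_of_isZero {X : C} (hX : IsZero X) : τ.free X := by
  obtain ⟨S, e, hS, -, h₃⟩ := τ.exists_shortExact X
  have := hS.epi_g
  have h : IsZero S.X₃ := IsZero.of_epi S.g (hX.of_iso e)
  exact τ.free.prop_of_iso (h.iso hX) h₃

variable [HasDerivedCategory.{w} C]

open DerivedCategory

/-- Objects `X` of `D(C)` with `Hⁱ(X) = 0` for `i > n + 1` and `Hⁿ⁺¹(X)` torsion. -/
def le (n : ℤ) : ObjectProperty (DerivedCategory C) := fun X ↦
  (∀ i : ℤ, n + 1 < i → IsZero ((homologyFunctor C i).obj X)) ∧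
    τ.tors ((homologyFunctor C (n + 1)).obj X)

/-- Objects `X` of `D(C)` with `Hⁱ(X) = 0` for `i < n` and `Hⁿ(X)` torsion-free. -/
def ge (n : ℤ) : ObjectProperty (DerivedCategory C) := fun X ↦
  (∀ i : ℤ, i < n → IsZero ((homologyFunctor C i).obj X)) ∧
    τ.free ((homologyFunctor C n).obj X)

instance (n : ℤ) : (τ.le n).IsClosedUnderIsomorphisms where
  of_iso e h := ⟨fun i hi ↦ (h.1 i hi).of_iso ((homologyFunctor C i).mapIso e.symm),
    τ.tors.prop_of_iso ((homologyFunctor C _).mapIso e) h.2⟩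

instance (n : ℤ) : (τ.ge n).IsClosedUnderIsomorphisms where
  of_iso e h := ⟨fun i hi ↦ (h.1 i hi).of_iso ((homologyFunctor C i).mapIso e.symm),
    τ.free.prop_of_iso ((homologyFunctor C _).mapIso e) h.2⟩

/-- `Hⁱ(X⟦a⟧) ≅ Hⁱ⁺ᵃ(X)` -/
noncomputable def homologyShiftIso (X : DerivedCategory C) (a i j : ℤ) (h : a + i = j) :
    (homologyFunctor C i).obj (X⟦a⟧) ≅ (homologyFunctor C j).obj X :=
  ((homologyFunctor C 0).shiftIso a i j h).app X

lemma le_shift (n a n' : ℤ) (h : a + n' = n) (X : DerivedCategory C) (hX : τ.le n X) :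
    τ.le n' (X⟦a⟧) :=
  ⟨fun i hi ↦ (hX.1 (a + i) (by lia)).of_iso (homologyShiftIso X a i _ rfl),
    τ.tors.prop_of_iso (homologyShiftIso X a (n' + 1) (n + 1) (by lia)).symm hX.2⟩

lemma ge_shift (n a n' : ℤ) (h : a + n' = n) (X : DerivedCategory C) (hX : τ.ge n X) :
    τ.ge n' (X⟦a⟧) :=
  ⟨fun i hi ↦ (hX.1 (a + i) (by lia)).of_iso (homologyShiftIso X a i _ rfl),
    τ.free.prop_of_iso (homologyShiftIso X a n' n (by lia)).symm hX.2⟩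

lemma isLE_of_le {n : ℤ} {X : DerivedCategory C} (h : τ.le n X) : X.IsLE (n + 1) :=
  (isLE_iff _ _).2 h.1

lemma isGE_of_ge {n : ℤ} {X : DerivedCategory C} (h : τ.ge n X) : X.IsGE n :=
  (isGE_iff _ _).2 h.1

lemma le_of_isLE {n : ℤ} {X : DerivedCategory C} (h : X.IsLE n) : τ.le n X :=
  ⟨fun i hi ↦ X.isZero_of_isLE n i (by lia), τ.tors_of_isZero (X.isZero_of_isLE n _ (by lia))⟩

lemma ge_of_isGE {n m : ℤ} {X : DerivedCategory C} (h : X.IsGE m) (hnm : n < m) : τ.ge n X :=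
  ⟨fun i hi ↦ X.isZero_of_isGE m i (by lia), τ.free_of_isZero (X.isZero_of_isGE m _ (by lia))⟩

lemma le_single {n m : ℤ} (h : n + 1 = m) {T : C} (hT : τ.tors T) :
    τ.le n ((singleFunctor C m).obj T) := by
  subst h
  exact ⟨fun i hi ↦ isZero_of_isLE _ (n + 1) i hi,
    τ.tors.prop_of_iso ((singleFunctorCompHomologyFunctorIso C (n + 1)).app T).symm hT⟩

lemma ge_single {n : ℤ} {F : C} (hF : τ.free F) : τ.ge n ((singleFunctor C n).obj F) :=
  ⟨fun i hi ↦ isZero_of_isGE _ n i hi,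
    τ.free.prop_of_iso ((singleFunctorCompHomologyFunctorIso C n).app F).symm hF⟩

lemma le_of_distTriang (T : Triangle (DerivedCategory C)) (hT : T ∈ distTriang _) (n : ℤ)
    (h₁ : T.obj₁.IsLE n) (h₃ : τ.le n T.obj₃) : τ.le n T.obj₂ := by
  have h₁' : T.obj₁.IsLE (n + 1) := TStructure.t.isLE_of_le _ n (n + 1)
  have h₂ : T.obj₂.IsLE (n + 1) := TStructure.t.isLE₂ T hT _ h₁' (τ.isLE_of_le h₃)
  refine ⟨(isLE_iff _ _).1 h₂, ?_⟩
  have z := T.obj₁.isZero_of_isLE n (n + 1) (by lia)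
  have z' := T.obj₁.isZero_of_isLE n (n + 1 + 1) (by lia)
  have : Mono ((homologyFunctor C (n + 1)).map T.mor₂) :=
    (HomologySequence.mono_homologyMap_mor₂_iff T hT _).2 (z.eq_of_src _ _)
  have : Epi ((homologyFunctor C (n + 1)).map T.mor₂) :=
    (HomologySequence.epi_homologyMap_mor₂_iff T hT _ (n + 1 + 1) rfl).2 (z'.eq_of_tgt _ _)
  have := isIso_of_mono_of_epi ((homologyFunctor C (n + 1)).map T.mor₂)
  exact τ.tors.prop_of_iso (asIso ((homologyFunctor C (n + 1)).map T.mor₂)).symm h₃.2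

lemma ge_of_distTriang (T : Triangle (DerivedCategory C)) (hT : T ∈ distTriang _) (n m : ℤ)
    (hnm : n < m) (h₁ : τ.ge n T.obj₁) (h₃ : T.obj₃.IsGE m) : τ.ge n T.obj₂ := by
  have h₃' : T.obj₃.IsGE n := TStructure.t.isGE_of_ge _ n m
  have h₂ : T.obj₂.IsGE n := TStructure.t.isGE₂ T hT _ (τ.isGE_of_ge h₁) h₃'
  refine ⟨(isGE_iff _ _).1 h₂, ?_⟩
  have z := T.obj₃.isZero_of_isGE m n (by lia)
  have z' := T.obj₃.isZero_of_isGE m (n - 1) (by lia)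
  have : Epi ((homologyFunctor C n).map T.mor₁) :=
    (HomologySequence.epi_homologyMap_mor₁_iff T hT _).2 (z.eq_of_tgt _ _)
  have : Mono ((homologyFunctor C n).map T.mor₁) :=
    (HomologySequence.mono_homologyMap_mor₁_iff T hT (n - 1) n (by lia)).2 (z'.eq_of_src _ _)
  have := isIso_of_mono_of_epi ((homologyFunctor C n).map T.mor₁)
  exact τ.free.prop_of_iso (asIso ((homologyFunctor C n).map T.mor₁)) h₁.2

lemma exists_iso_single_of_le {n m : ℤ} (h : n + 1 = m) {X : DerivedCategory C} (hX : τ.le n X)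
    (hX' : X.IsGE m) : ∃ (T : C) (_ : τ.tors T), Nonempty (X ≅ (singleFunctor C m).obj T) := by
  subst h
  have := τ.isLE_of_le hX
  obtain ⟨T, ⟨e⟩⟩ := X.exists_iso_singleFunctor_obj_of_isGE_of_isLE (n + 1)
  exact ⟨T, τ.tors.prop_of_iso ((homologyFunctor C (n + 1)).mapIso e ≪≫
    (singleFunctorCompHomologyFunctorIso C (n + 1)).app T) hX.2, ⟨e⟩⟩

lemma exists_iso_single_of_ge {n : ℤ} {X : DerivedCategory C} (hX : τ.ge n X)
    (hX' : X.IsLE n) : ∃ (F : C) (_ : τ.free F), Nonempty (X ≅ (singleFunctor C n).obj F) := by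
  have := τ.isGE_of_ge hX
  obtain ⟨F, ⟨e⟩⟩ := X.exists_iso_singleFunctor_obj_of_isGE_of_isLE n
  exact ⟨F, τ.free.prop_of_iso ((homologyFunctor C n).mapIso e ≪≫
    (singleFunctorCompHomologyFunctorIso C n).app F) hX.2, ⟨e⟩⟩

lemma le_truncGE {n m : ℤ} (h : n + 1 = m) {X : DerivedCategory C} (hX : τ.le n X) :
    τ.le n ((TStructure.t.truncGE m).obj X) := by
  subst h
  have := τ.isLE_of_le hX
  refine ⟨(isLE_iff _ _).1 inferInstance, ?_⟩
  have hT := TStructure.t.triangleLEGE_distinguished n (n + 1) rfl X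
  let T := (TStructure.t.triangleLEGE n (n + 1) rfl).obj X
  have h₁ : T.obj₁.IsLE n := inferInstanceAs (((TStructure.t.truncLE n).obj X).IsLE n)
  have z := T.obj₁.isZero_of_isLE n (n + 1) (by lia)
  have z' := T.obj₁.isZero_of_isLE n (n + 1 + 1) (by lia)
  have : Mono ((homologyFunctor C (n + 1)).map T.mor₂) :=
    (HomologySequence.mono_homologyMap_mor₂_iff T hT _).2 (z.eq_of_src _ _)
  have : Epi ((homologyFunctor C (n + 1)).map T.mor₂) :=
    (HomologySequence.epi_homologyMap_mor₂_iff T hT _ (n + 1 + 1) rfl).2 (z'.eq_of_tgt _ _)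
  have := isIso_of_mono_of_epi ((homologyFunctor C (n + 1)).map T.mor₂)
  exact τ.tors.prop_of_iso
    (@asIso _ _ _ _ ((homologyFunctor C (n + 1)).map T.mor₂) this) hX.2

lemma ge_truncLE {n : ℤ} {X : DerivedCategory C} (hX : τ.ge n X) :
    τ.ge n ((TStructure.t.truncLE n).obj X) := by
  have := τ.isGE_of_ge hX
  refine ⟨(isGE_iff _ _).1 inferInstance, ?_⟩
  have hT := TStructure.t.triangleLEGE_distinguished n (n + 1) rfl X
  let T := (TStructure.t.triangleLEGE n (n + 1) rfl).obj X
  have h₁ : T.obj₃.IsGE (n + 1) :=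
    inferInstanceAs (((TStructure.t.truncGE (n + 1)).obj X).IsGE (n + 1))
  have z := T.obj₃.isZero_of_isGE (n + 1) n (by lia)
  have z' := T.obj₃.isZero_of_isGE (n + 1) (n - 1) (by lia)
  have : Epi ((homologyFunctor C n).map T.mor₁) :=
    (HomologySequence.epi_homologyMap_mor₁_iff T hT _).2 (z.eq_of_tgt _ _)
  have : Mono ((homologyFunctor C n).map T.mor₁) :=
    (HomologySequence.mono_homologyMap_mor₁_iff T hT (n - 1) n (by lia)).2 (z'.eq_of_src _ _)
  have := isIso_of_mono_of_epi ((homologyFunctor C n).map T.mor₁)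
  exact τ.free.prop_of_iso (asIso ((homologyFunctor C n).map T.mor₁)).symm hX.2

lemma hom_eq_zero_of_le_of_ge ⦃X Y : DerivedCategory C⦄ (f : X ⟶ Y) (hX : τ.le 0 X)
    (hY : τ.ge 1 Y) : f = 0 := by
  have hX' : X.IsLE 1 := τ.isLE_of_le hX
  have hY' : Y.IsGE 1 := τ.isGE_of_ge hY
  obtain ⟨f, rfl⟩ : ∃ f', f = (TStructure.t.truncGEπ 1).app X ≫ f' :=
    ⟨_, (TStructure.t.π_descTruncGE f 1).symm⟩
  obtain ⟨f, rfl⟩ : ∃ f', f = f' ≫ (TStructure.t.truncLEι 1).app Y :=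
    ⟨_, (TStructure.t.liftTruncLE_ι f 1).symm⟩
  obtain ⟨T, hT, ⟨e⟩⟩ := τ.exists_iso_single_of_le (zero_add 1) (τ.le_truncGE (zero_add 1) hX)
    inferInstance
  obtain ⟨F, hF, ⟨e'⟩⟩ := τ.exists_iso_single_of_ge (τ.ge_truncLE hY) inferInstance
  obtain ⟨g, hg⟩ := (singleFunctor C 1).map_surjective (e.inv ≫ f ≫ e'.hom)
  have : f = 0 := by
    rw [τ.hom_eq_zero hT hF g, Functor.map_zero] at hg
    rw [← cancel_epi e.inv, ← cancel_mono e'.hom, Category.assoc, ← hg, comp_zero, zero_comp]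
  rw [this, zero_comp, comp_zero]

/-- The distinguished triangle with vertices `S.X₁[-n]`, `S.X₂[-n]`, `S.X₃[-n]` given by a short
exact sequence `S`. -/
lemma exists_single_distTriang {S : ShortComplex C} (hS : S.ShortExact) (n : ℤ) :
    ∃ (f : (singleFunctor C n).obj S.X₁ ⟶ (singleFunctor C n).obj S.X₂)
      (g : (singleFunctor C n).obj S.X₂ ⟶ (singleFunctor C n).obj S.X₃)
      (h : (singleFunctor C n).obj S.X₃ ⟶ ((singleFunctor C n).obj S.X₁)⟦(1 : ℤ)⟧),
      Triangle.mk f g h ∈ distTriang _ :=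
  ⟨_, _, _, triangleOfSES_distinguished
    (hS.map_of_exact (HomologicalComplex.single C (ComplexShape.up ℤ) n))⟩

lemma exists_triangle (A : DerivedCategory C) :
    ∃ (X Y : DerivedCategory C) (_ : τ.le 0 X) (_ : τ.ge 1 Y) (f : X ⟶ A) (g : A ⟶ Y)
      (h : Y ⟶ X⟦(1 : ℤ)⟧), Triangle.mk f g h ∈ distTriang _ := by
  -- `M` is `τ^{≥ 1} A` and `L` is `τ^{≤ 1} τ^{≥ 1} A`
  let M := (TStructure.t.truncGE 1).obj A
  let L := (TStructure.t.truncLE 1).obj M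
  obtain ⟨B, ⟨e⟩⟩ := L.exists_iso_singleFunctor_obj_of_isGE_of_isLE 1
  obtain ⟨S, e', hS, hT, hF⟩ := τ.exists_shortExact B
  obtain ⟨a, b, c, habc⟩ := exists_single_distTriang hS 1
  let i : (singleFunctor C 1).obj S.X₂ ≅ L := (singleFunctor C 1).mapIso e' ≪≫ e.symm
  have h₂ := TStructure.distTriang_of_iso₁ (TStructure.t.triangleLEGE_distinguished 1 2 rfl M) i
  obtain ⟨Y, p, q, hY⟩ := distinguished_cocone_triangle
    (a ≫ i.hom ≫ (TStructure.t.truncLEι 1).app M)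
  have hYge : τ.ge 1 Y := τ.ge_of_distTriang _ (someOctahedron rfl habc h₂ hY).mem 1 2 (by lia)
    (τ.ge_single hF) (inferInstanceAs (((TStructure.t.truncGE 2).obj M).IsGE 2))
  obtain ⟨X, r, s, hX⟩ := distinguished_cocone_triangle₁ ((TStructure.t.truncGEπ 1).app A ≫ p)
  have oct := someOctahedron rfl
    (rot_of_distTriang _ (TStructure.t.triangleLEGE_distinguished 0 1 rfl A))
    (rot_of_distTriang _ hY) (rot_of_distTriang _ hX)
  have hX₁ : τ.le (-1) (X⟦(1 : ℤ)⟧) := τ.le_of_distTriang _ oct.mem (-1)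
    (TStructure.t.isLE_shift ((TStructure.t.truncLE 0).obj A) 0 1 (-1))
    (τ.le_shift 0 1 (-1) (by lia) _ (τ.le_single (by lia) hT))
  have hXle : τ.le 0 X := (τ.le 0).prop_of_iso ((shiftEquiv _ (1 : ℤ)).unitIso.app X).symm
    (τ.le_shift (-1) (-1) 0 (by lia) _ hX₁)
  exact ⟨X, Y, hXle, hYge, r, _, s, hX⟩

/-- The t-structure on `D(C)` attached to a torsion pair. -/
noncomputable def tStructure : TStructure (DerivedCategory C) where
  le := τ.le
  ge := τ.ge
  le_shift := τ.le_shift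
  ge_shift := τ.ge_shift
  zero' := τ.hom_eq_zero_of_le_of_ge
  le_zero_le _ hX := τ.le_of_isLE (τ.isLE_of_le hX)
  ge_one_le _ hX := τ.ge_of_isGE (τ.isGE_of_ge hX) (by lia)
  exists_triangle_zero_one := τ.exists_triangle

instance : (TStructure.t (C := C)).bounded.HasInducedTStructure τ.tStructure where
  exists_triangle_zero_one A hA := by
    obtain ⟨X, Y, hX, hY, f, g, h, hT⟩ := τ.exists_triangle A
    have hX' : X.IsLE 1 := τ.isLE_of_le hX
    have hY' : Y.IsGE 1 := τ.isGE_of_ge hY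
    obtain ⟨⟨a, ha⟩, ⟨b, hb⟩⟩ := hA
    have hYp : TStructure.t.plus Y := ⟨1, hY'⟩
    have hXp : TStructure.t.plus X :=
      TStructure.t.plus.ext_of_isTriangulatedClosed₁ _ hT ⟨a, ha⟩ hYp
    have hXm : TStructure.t.minus X := ⟨1, hX'⟩
    have hYm : TStructure.t.minus Y :=
      TStructure.t.minus.ext_of_isTriangulatedClosed₃ _ hT hXm ⟨b, hb⟩
    exact ⟨X, Y, ⟨hX⟩, ⟨hY⟩, f, g, h, hT,
      ObjectProperty.le_isoClosure _ _ ⟨hXp, hXm⟩, ObjectProperty.le_isoClosure _ _ ⟨hYp, hYm⟩⟩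

/-- The t-structure on `Dᵇ(C)` attached to a torsion pair `(𝒯, ℱ)`: `X` is `≤ 0` if `Hⁱ(X) = 0`
for `i > 1` and `H¹(X) ∈ 𝒯`, and `X` is `≥ 0` if `Hⁱ(X) = 0` for `i < 0` and `H⁰(X) ∈ ℱ`. -/
noncomputable def boundedTStructure : TStructure (Bounded C) :=
  (TStructure.t (C := C)).bounded.tStructure τ.tStructure

lemma boundedTStructure_le_zero_iff (X : Bounded C) :
    τ.boundedTStructure.le 0 X ↔
      X.obj.IsLE 1 ∧ τ.tors ((homologyFunctor C 1).obj X.obj) := by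
  rw [isLE_iff]
  exact Iff.rfl

lemma boundedTStructure_ge_zero_iff (X : Bounded C) :
    τ.boundedTStructure.ge 0 X ↔
      X.obj.IsGE 0 ∧ τ.free ((homologyFunctor C 0).obj X.obj) := by
  rw [isGE_iff]
  exact Iff.rfl

/-- The tilt `ᵖC` of `C` with respect to a torsion pair: the heart of the t-structure
`boundedTStructure` on `Dᵇ(C)`, an abelian category by `TStructure.heart_abelian`. -/
abbrev Tilt : Type (max u v) := τ.boundedTStructure.heart.FullSubcategory

lemma bounded_single (X : C) :
    (TStructure.t (C := C)).bounded ((singleFunctor C 0).obj X) :=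
  ⟨⟨0, inferInstance⟩, ⟨0, inferInstance⟩⟩

lemma heart_single {F : C} (hF : τ.free F) :
    τ.boundedTStructure.heart (⟨(singleFunctor C 0).obj F, bounded_single F⟩ : Bounded C) :=
  ⟨τ.le_of_isLE (n := 0) (X := (singleFunctor C 0).obj F) inferInstance, τ.ge_single hF⟩

/-- The inclusion `ℱ ⥤ ᵖC`, which sends `F` to the complex `F` placed in degree `0`. -/
noncomputable def freeToTilt : τ.free.FullSubcategory ⥤ τ.Tilt :=
  τ.boundedTStructure.heart.lift
    ((TStructure.t (C := C)).bounded.lift (τ.free.ι ⋙ singleFunctor C 0)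
      (fun F ↦ bounded_single F.obj))
    (fun F ↦ τ.heart_single F.property)

instance : τ.freeToTilt.Additive where
  map_add {X Y f g} := by
    apply τ.boundedTStructure.heart.ι.map_injective
    apply (TStructure.t (C := C)).bounded.ι.map_injective
    exact (singleFunctor C 0).map_add

end TorsionPair

/-! The class `ℱ` sits in two abelian categories, and for a cotilting pair both derived categories
are Verdier quotients of the homotopy category K(`ℱ`) by the same subcategory.

In `C`, the class `ℱ` is closed under subobjects and every object is a quotient of an object of `ℱ`.
In the tilt the situation is dual: `ℱ` is closed under quotients (`freeToTilt_essImage_of_epi`) and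
every object embeds into one of `ℱ` (`exists_mono_freeToTilt`). Resolutions by `ℱ` therefore have
length one, so that unbounded complexes are resolved by a single mapping cone, without limit
arguments (`exists_left_resolution`, `exists_right_resolution`). Hence K(`ℱ`) → D(`C`) and K(`ℱ`) →
D(ᵖ`C`) are localizations, whose kernels are the complexes acyclic in `C`, respectively in the tilt.

The kernels agree (`inverseImage_subcategoryAcyclic_eq`): an acyclic complex over `ℱ` is spliced
from short exact sequences with terms in `ℱ`, and for these exactness in either category means being
part of a distinguished triangle of D(`C`) (`shortExact_iff`). Uniqueness of localizations gives
`Φ`, compatible with complexes over `ℱ` by construction. It preserves boundedness in both directions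
by dévissage to single objects, which have length-one resolutions by `ℱ`. -/

namespace CategoryTheory

/-! ### Localization restricted to a full triangulated subcategory. -/

section TriangulatedLocalization

variable {T K D : Type*} [Category* T] [Category* K] [Category* D]
  [HasZeroObject T] [HasShift T ℤ] [Preadditive T]
  [∀ n : ℤ, (shiftFunctor T n).Additive] [Pretriangulated T]
  [HasZeroObject K] [HasShift K ℤ] [Preadditive K]
  [∀ n : ℤ, (shiftFunctor K n).Additive] [Pretriangulated K]

lemma ObjectProperty.trW_inverseImage_iff (B : ObjectProperty K) [B.IsTriangulated]
    [B.IsClosedUnderIsomorphisms] (j : T ⥤ K) [j.CommShift ℤ] [j.IsTriangulated]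
    {X Y : T} (f : X ⟶ Y) :
    (B.inverseImage j).trW f ↔ B.trW (j.map f) := by
  obtain ⟨Z, g, h, hT⟩ := distinguished_cocone_triangle f
  have h₁ := (B.inverseImage j).trW_iff_of_distinguished _ hT
  have h₂ := B.trW_iff_of_distinguished _ (j.map_distinguished _ hT)
  exact h₁.trans h₂.symm

/-- If the essential image of a fully faithful triangulated functor `j` is suitably localizing for
the kernel of a localization functor `L`, then `j ⋙ L` is a localization functor. -/
lemma Functor.isLocalization_comp_of_isLocalizedFullyFaithful (B : ObjectProperty K)
    [B.IsTriangulated] [B.IsClosedUnderIsomorphisms] (j : T ⥤ K) [j.CommShift ℤ]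
    [j.IsTriangulated] [j.Full] [j.Faithful] (L : K ⥤ D) [L.IsLocalization B.trW]
    [(j.essImage.triangulatedLocalizerMorphism B).IsLocalizedFullyFaithful]
    [(j ⋙ L).EssSurj] :
    (j ⋙ L).IsLocalization (B.inverseImage j).trW := by
  have : (j.essImage.ι ⋙ L).EssSurj := ⟨fun Y ↦
    ⟨j.toEssImage.obj ((j ⋙ L).objPreimage Y), ⟨(j ⋙ L).objObjPreimageIso Y⟩⟩⟩
  have : (j.essImage.ι ⋙ L).IsLocalization (B.inverseImage j.essImage.ι).trW :=
    (j.essImage.triangulatedLocalizerMorphism B).isLocalization_of_isLocalizedFullyFaithful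
      (F := 𝟭 D) (Functor.rightUnitor _).symm
  -- The criterion applies to the honest full subcategory `j.essImage`; the result is carried to `T`
  -- along the equivalence of `T` with this image.
  refine Functor.IsLocalization.of_equivalence_source (j.essImage.ι ⋙ L)
    (B.inverseImage j.essImage.ι).trW _ _ j.toEssImage.asEquivalence.symm ?_ ?_ ?_
  · intro X Y f hf
    refine MorphismProperty.le_isoClosure _ _ ?_
    rw [ObjectProperty.trW_inverseImage_iff] at hf ⊢
    refine (MorphismProperty.arrow_mk_iso_iff _ ?_).1 hf
    exact (Arrow.isoOfNatIso (Functor.isoWhiskerRight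
      j.toEssImage.asEquivalence.counitIso j.essImage.ι) (Arrow.mk f)).symm
  · intro X Y f hf
    exact Localization.inverts L B.trW _ ((B.trW_inverseImage_iff j f).1 hf)
  · exact Functor.isoWhiskerRight j.toEssImage.asEquivalence.counitIso (j.essImage.ι ⋙ L)

end TriangulatedLocalization

/-! ### Uniqueness of triangulated localizations. -/

section Uniqueness

variable {T D₁ D₂ : Type*} [Category* T] [Category* D₁] [Category* D₂]
  [HasZeroObject T] [HasShift T ℤ] [Preadditive T]
  [∀ n : ℤ, (shiftFunctor T n).Additive] [Pretriangulated T] [IsTriangulated T]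
  [HasZeroObject D₁] [HasShift D₁ ℤ] [Preadditive D₁]
  [∀ n : ℤ, (shiftFunctor D₁ n).Additive] [Pretriangulated D₁]
  [HasZeroObject D₂] [HasShift D₂ ℤ] [Preadditive D₂]
  [∀ n : ℤ, (shiftFunctor D₂ n).Additive] [Pretriangulated D₂]

/-- A functor induced on a triangulated localization by a triangulated functor is triangulated. -/
lemma Localization.exists_isTriangulated_of_lifting (N : ObjectProperty T) [N.IsTriangulated]
    (L₁ : T ⥤ D₁) (L₂ : T ⥤ D₂) [L₁.CommShift ℤ] [L₂.CommShift ℤ]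
    [L₁.IsTriangulated] [L₂.IsTriangulated] [L₁.IsLocalization N.trW]
    (F : D₁ ⥤ D₂) [Localization.Lifting L₁ N.trW L₂ F] :
    ∃ (_ : F.CommShift ℤ), F.IsTriangulated := by
  let := Functor.commShiftOfLocalization L₁ N.trW ℤ L₂ F
  -- Every morphism of `D₁` lifts to `T` up to isomorphism, so every distinguished triangle of `D₁`
  -- is isomorphic to the image of one in `T`.
  have := Localization.essSurj_mapArrow L₁ N.trW
  exact ⟨inferInstance, Functor.isTriangulated_of_precomp_iso
    (Localization.Lifting.iso L₁ N.trW L₂ F)⟩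

/-- Two triangulated localization functors with the same kernel have equivalent targets, as
triangulated categories. -/
lemma Localization.exists_triangulated_equivalence (N : ObjectProperty T) [N.IsTriangulated]
    (L₁ : T ⥤ D₁) (L₂ : T ⥤ D₂) [L₁.CommShift ℤ] [L₂.CommShift ℤ]
    [L₁.IsTriangulated] [L₂.IsTriangulated]
    [L₁.IsLocalization N.trW] [L₂.IsLocalization N.trW] :
    ∃ (Φ : D₁ ≌ D₂) (_ : Φ.functor.CommShift ℤ) (_ : Φ.inverse.CommShift ℤ),
      Φ.functor.IsTriangulated ∧ Φ.inverse.IsTriangulated ∧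
      Nonempty (L₁ ⋙ Φ.functor ≅ L₂) ∧ Nonempty (L₂ ⋙ Φ.inverse ≅ L₁) := by
  obtain ⟨c, hc⟩ := exists_isTriangulated_of_lifting N L₁ L₂ (uniq L₁ L₂ N.trW).functor
  obtain ⟨c', hc'⟩ := exists_isTriangulated_of_lifting N L₂ L₁ (uniq L₁ L₂ N.trW).inverse
  exact ⟨uniq L₁ L₂ N.trW, c, c', hc, hc', ⟨compUniqFunctor _ _ _⟩, ⟨compUniqInverse _ _ _⟩⟩

end Uniqueness

/-! ### Restricting triangulated equivalences to subcategories. -/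

section Restriction

variable {D₁ D₂ : Type*} [Category* D₁] [Category* D₂]
  [HasZeroObject D₁] [HasShift D₁ ℤ] [Preadditive D₁]
  [∀ n : ℤ, (shiftFunctor D₁ n).Additive] [Pretriangulated D₁]
  [HasZeroObject D₂] [HasShift D₂ ℤ] [Preadditive D₂]
  [∀ n : ℤ, (shiftFunctor D₂ n).Additive] [Pretriangulated D₂]

/-- A triangulated equivalence restricts to triangulated subcategories it preserves in both
directions. -/
lemma Equivalence.exists_triangulated_restriction (Φ : D₁ ≌ D₂) [Φ.functor.CommShift ℤ]
    [Φ.functor.IsTriangulated] (P₁ : ObjectProperty D₁) (P₂ : ObjectProperty D₂)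
    [P₁.IsTriangulated] [P₂.IsTriangulated] [P₂.IsClosedUnderIsomorphisms]
    (h₁ : ∀ X, P₁ X → P₂ (Φ.functor.obj X)) (h₂ : ∀ Y, P₂ Y → P₁ (Φ.inverse.obj Y)) :
    ∃ (Ψ : P₁.FullSubcategory ≌ P₂.FullSubcategory) (_ : Ψ.functor.CommShift ℤ),
      Ψ.functor.IsTriangulated ∧ Nonempty (Ψ.functor ⋙ P₂.ι ≅ P₁.ι ⋙ Φ.functor) := by
  have : (P₂.lift (P₁.ι ⋙ Φ.functor) (fun X ↦ h₁ _ X.property)).EssSurj := ⟨fun Y ↦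
    ⟨⟨_, h₂ _ Y.property⟩, ⟨P₂.ι.preimageIso (Φ.counitIso.app Y.obj)⟩⟩⟩
  have : (P₂.lift (P₁.ι ⋙ Φ.functor) (fun X ↦ h₁ _ X.property)).IsEquivalence := { }
  obtain ⟨c, hc⟩ :
      ∃ (_ : (P₂.lift (P₁.ι ⋙ Φ.functor) (fun X ↦ h₁ _ X.property)).CommShift ℤ),
      (P₂.lift (P₁.ι ⋙ Φ.functor) (fun X ↦ h₁ _ X.property)).IsTriangulated :=
    ⟨inferInstance, inferInstance⟩
  exact ⟨(P₂.lift (P₁.ι ⋙ Φ.functor) (fun X ↦ h₁ _ X.property)).asEquivalence, c, hc,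
    ⟨P₂.liftCompιIso _ _⟩⟩

end Restriction

end CategoryTheory

namespace CategoryTheory

/-! ### Localizing subcategories obtained from resolutions. -/

section Localizing

variable {K : Type*} [Category* K] [HasZeroObject K] [HasShift K ℤ] [Preadditive K]
  [∀ n : ℤ, (shiftFunctor K n).Additive] [Pretriangulated K]
  (A B : ObjectProperty K) [A.IsTriangulated] [A.IsClosedUnderIsomorphisms]

lemma ObjectProperty.trW_inf_of_prop {X Y : K} {s : X ⟶ Y} (hs : B.trW s) (hX : A X) (hY : A Y) :
    (A ⊓ B).trW s := by
  obtain ⟨Z, g, h, hT, hZ⟩ := (B.trW_iff s).1 hs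
  exact ((A ⊓ B).trW_iff s).2 ⟨Z, g, h, hT, A.ext_of_isTriangulatedClosed₃ _ hT hX hY, hZ⟩

variable [IsTriangulated K] [B.IsTriangulated] [B.IsClosedUnderIsomorphisms]

/-- Precomposing `s : X ⟶ Y` with a resolution of `X` gives a morphism between objects of `A`; its
cone lies in `B`, and in `A` since `A` is triangulated. -/
lemma ObjectProperty.isVerdierLeftLocalizing_of_exists
    (h : ∀ X : K, ∃ (Z : K) (s : Z ⟶ X), A Z ∧ B.trW s) : A.IsVerdierLeftLocalizing B := by
  rw [isVerdierLeftLocalizing_iff]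
  intro X Y s hY hs
  obtain ⟨Z, t, hZ, ht⟩ := h X
  exact ⟨Z, t ≫ s, t, hZ, trW_inf_of_prop _ _ (MorphismProperty.comp_mem _ _ _ ht hs) hZ hY, rfl⟩

lemma ObjectProperty.isVerdierRightLocalizing_of_exists
    (h : ∀ X : K, ∃ (Z : K) (s : X ⟶ Z), A Z ∧ B.trW s) : A.IsVerdierRightLocalizing B := by
  rw [isVerdierRightLocalizing_iff]
  intro X Y s hX hs
  obtain ⟨Z, t, hZ, ht⟩ := h Y
  exact ⟨Z, s ≫ t, t, hZ, trW_inf_of_prop _ _ (MorphismProperty.comp_mem _ _ _ hs ht) hX hZ, rfl⟩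

end Localizing

/-! ### Resolutions of unbounded complexes. -/

section Resolutions

open HomologicalComplex CochainComplex CochainComplex.HomComplex

variable {E A : Type*} [Category* E] [Preadditive E] [Category* A]
  [Abelian A] (j : E ⥤ A) [j.Additive]

lemma Functor.essImage_mapHomologicalComplex [j.Full] [j.Faithful] {ι : Type*}
    {c : ComplexShape ι} (X : HomologicalComplex A c) (hX : ∀ i, j.essImage (X.X i)) :
    (j.mapHomologicalComplex c).essImage X :=
  ⟨{ X i := (hX i).witness
     d i k := j.preimage ((hX i).getIso.hom ≫ X.d i k ≫ (hX k).getIso.inv)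
     shape i k h := j.map_injective (by simp [X.shape i k h])
     d_comp_d' i k l _ _ := j.map_injective (by simp) },
   ⟨Hom.isoOfComponents (fun i ↦ (hX i).getIso) (fun i k _ ↦ by
     change _ = j.map (j.preimage _) ≫ _
     rw [j.map_preimage, Category.assoc, Category.assoc, Iso.inv_hom_id, Category.comp_id]
     rfl)⟩⟩

lemma Functor.essImage_mapHomotopyCategory [j.Full] [j.Faithful] (X : CochainComplex A ℤ)
    (hX : ∀ i, j.essImage (X.X i)) :
    (j.mapHomotopyCategory (.up ℤ)).essImage ((HomotopyCategory.quotient A _).obj X) := by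
  obtain ⟨K, ⟨e⟩⟩ := j.essImage_mapHomologicalComplex X hX
  exact ⟨(HomotopyCategory.quotient E _).obj K,
    ⟨(HomotopyCategory.quotient A _).mapIso e⟩⟩

lemma trW_subcategoryAcyclic_quotient_map {K L : CochainComplex A ℤ} (f : K ⟶ L) [QuasiIso f] :
    (HomotopyCategory.subcategoryAcyclic A).trW ((HomotopyCategory.quotient A _).map f) := by
  rw [← HomotopyCategory.quasiIso_eq_trW_subcategoryAcyclic,
    HomotopyCategory.quotient_map_mem_quasiIso_iff]
  assumption

variable [HasBinaryBiproducts E]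

lemma Functor.essImage_biprod {X Y : A} (hX : j.essImage X) (hY : j.essImage Y) :
    j.essImage (X ⊞ Y) := by
  obtain ⟨X', ⟨e⟩⟩ := hX
  obtain ⟨Y', ⟨e'⟩⟩ := hY
  have := preservesBinaryBiproducts_of_preservesBiproducts j
  exact ⟨X' ⊞ Y', ⟨j.mapBiprod X' Y' ≪≫ biprod.mapIso e e'⟩⟩

lemma Functor.essImage_mappingCone_X {K L : CochainComplex A ℤ} (φ : K ⟶ L)
    (hK : ∀ n, j.essImage (K.X n)) (hL : ∀ n, j.essImage (L.X n)) (n : ℤ) :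
    j.essImage ((mappingCone φ).X n) :=
  j.essImage.prop_of_iso (homotopyCofiber.XIsoBiprod φ n (n + 1) rfl).symm
    (j.essImage_biprod (hK _) (hL _))

/-- A cochain complex is a quotient of a complex with terms in the essential image of `j` if
all objects are quotients of such terms. -/
lemma Functor.exists_epi_of_essImage (hj : ∀ X : A, ∃ (F : E) (p : j.obj F ⟶ X), Epi p)
    (X : CochainComplex A ℤ) :
    ∃ (P : CochainComplex A ℤ) (f : P ⟶ X), (∀ n, j.essImage (P.X n)) ∧ Epi f := by
  choose F p hp using fun n ↦ hj (X.X n)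
  -- The cone of `𝟙 Q` has terms `Q.X (n + 1) ⊞ Q.X n`. The index `n - 1` makes the first summand
  -- `j.obj (F n)`, which covers `X.X n` through `α`; the second summand receives the map forced by
  -- compatibility with the differentials.
  let Q : CochainComplex A ℤ :=
    { X n := j.obj (F (n - 1))
      d _ _ := 0 }
  let α : Cochain Q X (-1) := Cochain.mk (fun a b h ↦ p (a - 1) ≫ (X.XIsoOfEq (by lia)).hom)
  let β : Cocycle Q X 0 := Cocycle.mk (δ (-1) 0 α) 1 rfl (δ_δ _ _ _ _)
  have hn (n : ℤ) : n + 1 + -1 = n := by lia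
  have h₀ : δ (-1) 0 α = Cochain.ofHom (𝟙 Q ≫ β.homOf) := by simp [β]
  refine ⟨mappingCone (𝟙 Q), mappingCone.desc (𝟙 Q) α β.homOf h₀,
    j.essImage_mappingCone_X _ (fun _ ↦ j.obj_mem_essImage _) (fun _ ↦ j.obj_mem_essImage _), ?_⟩
  have (n : ℤ) : Epi ((mappingCone.desc (𝟙 Q) α β.homOf h₀).f n) := by
    have h := mappingCone.inl_v_desc_f (𝟙 Q) α β.homOf h₀ (n + 1) n (hn n)
    have : Epi (α.v (n + 1) n (hn n)) := by
      dsimp [α]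
      infer_instance
    rw [← h] at this
    exact epi_of_epi ((mappingCone.inl (𝟙 Q)).v (n + 1) n (hn n)) _
  exact HomologicalComplex.epi_of_epi_f _ this

/-- A cochain complex embeds into a complex with terms in the essential image of `j` if
all objects embed into such terms. -/
lemma Functor.exists_mono_of_essImage (hj : ∀ X : A, ∃ (F : E) (i : X ⟶ j.obj F), Mono i)
    (X : CochainComplex A ℤ) :
    ∃ (I : CochainComplex A ℤ) (f : X ⟶ I), (∀ n, j.essImage (I.X n)) ∧ Mono f := by
  choose F i hi using fun n ↦ hj (X.X n)
  -- Here `X.X n` embeds through `β` into the second summand `Q.X n` of the cone of `𝟙 Q`; the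
  -- component `α` is forced by `h₀`.
  let Q : CochainComplex A ℤ :=
    { X n := j.obj (F n)
      d _ _ := 0 }
  let β : Cochain X Q 0 := Cochain.ofHoms i
  let α : Cocycle X Q 1 := Cocycle.mk (-δ 0 1 β) 2 rfl (by simp [δ_δ])
  have h₀ : δ 0 1 β + α.1.comp (Cochain.ofHom (𝟙 Q)) (add_zero 1) = 0 := by simp [α]
  refine ⟨mappingCone (𝟙 Q), mappingCone.lift (𝟙 Q) α β h₀,
    j.essImage_mappingCone_X _ (fun _ ↦ j.obj_mem_essImage _) (fun _ ↦ j.obj_mem_essImage _), ?_⟩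
  have (n : ℤ) : Mono ((mappingCone.lift (𝟙 Q) α β h₀).f n) := by
    have h := mappingCone.lift_f_snd_v (𝟙 Q) α β h₀ n n (add_zero n)
    have : Mono (β.v n n (add_zero n)) := by
      dsimp [β]
      rw [Cochain.ofHoms_v]
      infer_instance
    rw [← h] at this
    exact mono_of_mono _ ((mappingCone.snd (𝟙 Q)).v n n (add_zero n))
  exact HomologicalComplex.mono_of_mono_f _ this

variable [j.Full] [j.Faithful]

/-- If the essential image of `j` is closed under subobjects and every object is a quotient of
an object in this essential image, then every object of the homotopy category has a left resolution
by a complex with terms in the essential image of `j`. -/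
lemma Functor.exists_left_resolution (hj : ∀ X : A, ∃ (F : E) (p : j.obj F ⟶ X), Epi p)
    (hj' : ∀ ⦃X Y : A⦄ (i : X ⟶ Y) [Mono i], j.essImage Y → j.essImage X)
    (X : HomotopyCategory A (.up ℤ)) :
    ∃ (Z : HomotopyCategory A (.up ℤ)) (s : Z ⟶ X),
      (j.mapHomotopyCategory (.up ℤ)).essImage Z ∧
        (HomotopyCategory.subcategoryAcyclic A).trW s := by
  obtain ⟨X, rfl⟩ := HomotopyCategory.quotient_obj_surjective X
  obtain ⟨P, f, hP, _⟩ := j.exists_epi_of_essImage hj X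
  -- The kernel of `f` has terms in the essential image, being termwise a subobject of `P`, so the
  -- cone of `kernel.ι f` is the resolution.
  let S := ShortComplex.mk (kernel.ι f) f (by simp)
  have hS : S.ShortExact :=
    { exact := ShortComplex.exact_of_f_is_kernel _ (kernelIsKernel f) }
  have := mappingCone.quasiIso_descShortComplex hS
  refine ⟨_, (HomotopyCategory.quotient A _).map (mappingCone.descShortComplex S),
    j.essImage_mapHomotopyCategory _ (j.essImage_mappingCone_X _ (fun n ↦ ?_) hP),
    trW_subcategoryAcyclic_quotient_map _⟩
  have : Mono (S.f.f n) := inferInstanceAs (Mono ((HomologicalComplex.eval A _ n).map S.f))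
  exact hj' (S.f.f n) (hP n)

/-- If the essential image of `j` is closed under quotients and every object embeds into
an object in this essential image, then every object of the homotopy category has a right resolution
by a complex with terms in the essential image of `j`. -/
lemma Functor.exists_right_resolution [HasZeroObject E]
    (hj : ∀ X : A, ∃ (F : E) (i : X ⟶ j.obj F), Mono i)
    (hj' : ∀ ⦃X Y : A⦄ (p : X ⟶ Y) [Epi p], j.essImage X → j.essImage Y)
    (X : HomotopyCategory A (.up ℤ)) :
    ∃ (Z : HomotopyCategory A (.up ℤ)) (s : X ⟶ Z),
      (j.mapHomotopyCategory (.up ℤ)).essImage Z ∧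
        (HomotopyCategory.subcategoryAcyclic A).trW s := by
  obtain ⟨X, rfl⟩ := HomotopyCategory.quotient_obj_surjective X
  obtain ⟨I, f, hI, _⟩ := j.exists_mono_of_essImage hj X
  let S := ShortComplex.mk f (cokernel.π f) (by simp)
  have hS : S.ShortExact :=
    { exact := ShortComplex.exact_of_g_is_cokernel _ (cokernelIsCokernel f) }
  have := mappingCone.quasiIso_descShortComplex hS
  have hQ (n : ℤ) : j.essImage (S.X₃.X n) := by
    have : Epi (S.g.f n) := inferInstanceAs (Epi ((HomologicalComplex.eval A _ n).map S.g))
    exact hj' (S.g.f n) (hI n)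
  obtain ⟨Z, a, b, hT⟩ :=
    distinguished_cocone_triangle ((HomotopyCategory.quotient A _).map S.g)
  have hZ : (j.mapHomotopyCategory (.up ℤ)).essImage Z :=
    ObjectProperty.ext_of_isTriangulatedClosed₃ _ _ hT
      (j.essImage_mapHomotopyCategory _ hI) (j.essImage_mapHomotopyCategory _ hQ)
  -- The triangle on `I ⟶ cone S.f ⟶ X⟦1⟧` is compared with the one on `I ⟶ S.X₃ ⟶ Z`. The identity
  -- of `I` and the quasi-isomorphism `φ` induce `c : X⟦1⟧ ⟶ Z` with acyclic cone, and shifting by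
  -- `-1` gives the resolution of `X`.
  have hT' := rot_of_distTriang _ (HomotopyCategory.mappingCone_triangleh_distinguished S.f)
  let φ : mappingCone S.f ⟶ S.X₃ := mappingCone.descShortComplex S
  obtain ⟨c, hc, -⟩ := MorphismProperty.compatible_with_triangulation
    (W := (HomotopyCategory.subcategoryAcyclic A).trW) _ _ hT' hT (𝟙 _)
    ((HomotopyCategory.quotient A _).map φ)
    (MorphismProperty.id_mem _ _) (trW_subcategoryAcyclic_quotient_map φ)
    (((HomotopyCategory.quotient A _).map_comp (mappingCone.inr S.f) φ).symm.trans
      ((congrArg _ (mappingCone.inr_descShortComplex S)).trans (Category.id_comp _).symm))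
  let e : (HomotopyCategory.quotient A (.up ℤ)).obj X ≅
      ((HomotopyCategory.quotient A (.up ℤ)).obj X)⟦(1 : ℤ)⟧⟦(-1 : ℤ)⟧ :=
    (shiftEquiv _ (1 : ℤ)).unitIso.app _
  refine ⟨Z⟦(-1 : ℤ)⟧, e.hom ≫ c⟦(-1 : ℤ)⟧', ObjectProperty.le_shift _ _ _ hZ, ?_⟩
  exact (MorphismProperty.cancel_left_of_respectsIso _ _ _).2
    ((MorphismProperty.IsCompatibleWithShift.iff _ c (-1 : ℤ)).2 hc)

end Resolutions

end CategoryTheory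

namespace CategoryTheory

/-! ### Comparing acyclicity in two abelian categories. -/

section Acyclic

/-- Exactness at `Y` depends only on the image of `f` and the kernel of `g`, which are unchanged by
an epimorphism before `i` and a monomorphism after `q`. -/
lemma ShortComplex.exact_iff_of_epi_mono_factorisation {A : Type*} [Category* A] [Abelian A]
    {X Z Y W V : A} {f : X ⟶ Y} {g : Y ⟶ V} (w : f ≫ g = 0) {i : Z ⟶ Y} {q : Y ⟶ W}
    (w' : i ≫ q = 0) (p : X ⟶ Z) (m : W ⟶ V) [Epi p] [Mono m] (hf : p ≫ i = f)
    (hg : q ≫ m = g) :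
    (ShortComplex.mk f g w).Exact ↔ (ShortComplex.mk i q w').Exact := by
  have w'' : i ≫ g = 0 := by rw [← hg, reassoc_of% w', zero_comp]
  let φ : ShortComplex.mk f g w ⟶ ShortComplex.mk i g w'' :=
    { τ₁ := p, τ₂ := 𝟙 _, τ₃ := 𝟙 _ }
  let ψ : ShortComplex.mk i q w' ⟶ ShortComplex.mk i g w'' :=
    { τ₁ := 𝟙 _, τ₂ := 𝟙 _, τ₃ := m }
  have : Epi φ.τ₁ := by assumption
  have : IsIso φ.τ₂ := inferInstanceAs (IsIso (𝟙 _))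
  have : Mono φ.τ₃ := inferInstanceAs (Mono (𝟙 _))
  have : Epi ψ.τ₁ := inferInstanceAs (Epi (𝟙 _))
  have : IsIso ψ.τ₂ := inferInstanceAs (IsIso (𝟙 _))
  have : Mono ψ.τ₃ := by assumption
  exact (ShortComplex.exact_iff_of_epi_of_isIso_of_mono φ).trans
    (ShortComplex.exact_iff_of_epi_of_isIso_of_mono ψ).symm

variable {E A₁ A₂ : Type*} [Category* E] [Preadditive E] [Category* A₁] [Abelian A₁]
  [Category* A₂] [Abelian A₂] (j₁ : E ⥤ A₁) (j₂ : E ⥤ A₂) [j₁.Additive] [j₂.Additive]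

/-- If the terms of an exact complex and its cycles belong to a subcategory, exactness may be tested
through another functor which preserves the short exact sequences of this subcategory. -/
lemma Functor.acyclic_of_acyclic [j₁.Full] [j₁.Faithful]
    (h₁ : ∀ ⦃X Y : E⦄ (f : X ⟶ Y), j₁.essImage (Abelian.image (j₁.map f)))
    (h₂ : ∀ (S : ShortComplex E), (S.map j₁).ShortExact → (S.map j₂).ShortExact)
    (K : CochainComplex E ℤ) (hK : ((j₁.mapHomologicalComplex (.up ℤ)).obj K).Acyclic) :
    ((j₂.mapHomologicalComplex (.up ℤ)).obj K).Acyclic := by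
  have fac (n : ℤ) : ∃ (Z : E) (p : K.X n ⟶ Z) (i : Z ⟶ K.X (n + 1)),
      p ≫ i = K.d n (n + 1) ∧ Epi (j₁.map p) ∧ Mono (j₁.map i) := by
    obtain ⟨Z, ⟨e⟩⟩ := h₁ (K.d n (n + 1))
    refine ⟨Z, j₁.preimage (Abelian.factorThruImage _ ≫ e.inv),
      j₁.preimage (e.hom ≫ Abelian.image.ι _), j₁.map_injective (by simp), ?_, ?_⟩
    all_goals
      rw [j₁.map_preimage]
      infer_instance
  choose Z p i hpi hp hi using fac
  have w (n : ℤ) : i n ≫ p (n + 1) = 0 := by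
    apply j₁.map_injective
    rw [← cancel_epi (j₁.map (p n)), ← cancel_mono (j₁.map (i (n + 1)))]
    simp only [← j₁.map_comp, Category.assoc, hpi, reassoc_of% (hpi n)]
    simp
  -- Acyclicity makes `Z n` the cycles in degree `n + 1`, so the complex is spliced from short exact
  -- sequences living in `E`, which `h₂` transports.
  have hS (n : ℤ) : ((ShortComplex.mk (i n) (p (n + 1)) (w n)).map j₁).ShortExact :=
    { exact := (ShortComplex.exact_iff_of_epi_mono_factorisation _ _ (j₁.map (p n))
        (j₁.map (i (n + 1))) ((j₁.map_comp _ _).symm.trans (congrArg j₁.map (hpi _)))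
        ((j₁.map_comp _ _).symm.trans (congrArg j₁.map (hpi _)))).1
          ((HomologicalComplex.exactAt_iff' _ n (n + 1) (n + 1 + 1) (by simp) (by simp)).1
            (hK (n + 1)))
      mono_f := hi n
      epi_g := hp (n + 1) }
  have (n : ℤ) : Epi (j₂.map (p n)) := by
    obtain ⟨n, rfl⟩ : ∃ m, n = m + 1 := ⟨n - 1, by lia⟩
    exact (h₂ _ (hS n)).epi_g
  intro n
  obtain ⟨n, rfl⟩ : ∃ m, n = m + 1 := ⟨n - 1, by lia⟩
  have : Mono (j₂.map (i (n + 1))) := (h₂ _ (hS (n + 1))).mono_f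
  exact (HomologicalComplex.exactAt_iff' _ n (n + 1) (n + 1 + 1) (by simp) (by simp)).2
    ((ShortComplex.exact_iff_of_epi_mono_factorisation _ _ (j₂.map (p n))
      (j₂.map (i (n + 1))) ((j₂.map_comp _ _).symm.trans (congrArg j₂.map (hpi _)))
      ((j₂.map_comp _ _).symm.trans (congrArg j₂.map (hpi _)))).2 (h₂ _ (hS n)).exact)

end Acyclic

end CategoryTheory

/-! ### Torsion-free objects inside `C` and inside the tilt. -/

namespace TorsionPair

variable {C : Type u} [Category.{v} C] [Abelian C] (τ : TorsionPair C)

/-- The torsion part of `X` maps to `X` by zero, so `X` is isomorphic to its torsion-free quotient.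
Thus `ℱ` is the right orthogonal of `𝒯`, and its closure properties become formal. -/
lemma free_of_hom_eq_zero {X : C} (h : ∀ ⦃T : C⦄ (_ : τ.tors T) (f : T ⟶ X), f = 0) :
    τ.free X := by
  obtain ⟨S, e, hS, h₁, h₃⟩ := τ.exists_shortExact X
  have hf : S.f = 0 := by
    rw [← cancel_mono e.hom, zero_comp]
    exact h h₁ _
  have := hS.epi_g
  have := hS.exact.mono_g hf
  have := isIso_of_mono_of_epi S.g
  exact τ.free.prop_of_iso ((asIso S.g).symm ≪≫ e) h₃

lemma free_of_mono {X Y : C} (i : X ⟶ Y) [Mono i] (hY : τ.free Y) : τ.free X :=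
  τ.free_of_hom_eq_zero fun T hT f ↦ by
    rw [← cancel_mono i, zero_comp]
    exact τ.hom_eq_zero hT hY _

lemma free_of_shortExact {S : ShortComplex C} (hS : S.Exact) (hf : Mono S.f) (h₁ : τ.free S.X₁)
    (h₃ : τ.free S.X₃) : τ.free S.X₂ :=
  τ.free_of_hom_eq_zero fun T hT f ↦ by
    rw [← hS.lift_f f (τ.hom_eq_zero hT h₃ _), τ.hom_eq_zero hT h₁ (hS.lift f _), zero_comp]

instance : τ.free.ContainsZero := ⟨0, isZero_zero C, τ.free_of_isZero (isZero_zero C)⟩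

instance : τ.free.IsClosedUnderBinaryProducts := ⟨by
  rintro X ⟨p⟩
  refine τ.free_of_hom_eq_zero fun T hT f ↦ p.isLimit.hom_ext fun j ↦ ?_
  rw [zero_comp, τ.hom_eq_zero hT (p.prop_diag_obj j) (f ≫ _)]⟩

instance : HasBinaryBiproducts τ.free.FullSubcategory :=
  have : τ.free.IsClosedUnderFiniteProducts := .mk'
  have : HasFiniteProducts τ.free.FullSubcategory := ⟨fun _ ↦ inferInstance⟩
  HasBinaryBiproducts.of_hasBinaryProducts

/-- Since `K` stops in degree 1, everything in that degree is a cycle, and the first cohomology is a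
quotient of `K.X 1`. -/
lemma _root_.CochainComplex.epi_homologyMap_of_epi_of_single (K : CochainComplex C ℤ) [K.IsStrictlyLE 1] {B : C}
    (φ : (HomologicalComplex.single C (.up ℤ) 1).obj B ⟶ K)
    (hφ : Epi (φ.f 1)) : Epi (HomologicalComplex.homologyMap φ 1) := by
  have h₁ : K.d 1 2 = 0 := (K.isZero_of_isStrictlyLE 1 2 (by lia)).eq_of_tgt _ _
  have := K.isIso_iCycles 1 2 (by simp) h₁
  have := ((HomologicalComplex.single C (.up ℤ) 1).obj B).isIso_iCycles 1 2 (by simp) rfl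
  have : Epi (HomologicalComplex.cyclesMap φ 1 ≫ K.iCycles 1) := by
    rw [HomologicalComplex.cyclesMap_i]
    infer_instance
  have : Epi (HomologicalComplex.cyclesMap φ 1) := by
    rw [← Category.comp_id (HomologicalComplex.cyclesMap φ 1), ← IsIso.hom_inv_id (K.iCycles 1),
      ← Category.assoc]
    infer_instance
  have : Epi (HomologicalComplex.homologyπ _ 1 ≫ HomologicalComplex.homologyMap φ 1) := by
    rw [HomologicalComplex.homologyπ_naturality]
    infer_instance
  exact epi_of_epi (HomologicalComplex.homologyπ _ 1) _

variable [HasDerivedCategory.{w} C]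

open DerivedCategory

/-- The inclusion of the tilt in the derived category. -/
noncomputable abbrev tiltι : τ.Tilt ⥤ DerivedCategory C :=
  τ.boundedTStructure.heart.ι ⋙ Bounded.ι

lemma tilt_le (X : τ.Tilt) : τ.le 0 (τ.tiltι.obj X) := X.property.1

lemma tilt_ge (X : τ.Tilt) : τ.ge 0 (τ.tiltι.obj X) := X.property.2

lemma tilt_hom_shift_eq_zero ⦃X Y : τ.Tilt⦄ ⦃n : ℤ⦄
    (f : τ.tiltι.obj X ⟶ (τ.tiltι.obj Y)⟦n⟧) (hn : n < 0) : f = 0 := by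
  have h₁ : τ.tStructure.IsLE (τ.tiltι.obj X) 0 := ⟨τ.tilt_le X⟩
  have h₂ : τ.tStructure.IsGE ((τ.tiltι.obj Y)⟦n⟧) (-n) :=
    ⟨τ.ge_shift 0 n (-n) (by lia) _ (τ.tilt_ge Y)⟩
  exact τ.tStructure.zero_of_isLE_of_isGE f 0 (-n) (by lia) h₁ h₂

/-- Negative extensions between objects of a heart vanish, so in a triangle with vertices in the
heart the first map is a kernel of the second and the second a cokernel of the first. -/
lemma tilt_shortExact_of_distTriang (S : ShortComplex τ.Tilt)
    (δ : τ.tiltι.obj S.X₃ ⟶ (τ.tiltι.obj S.X₁)⟦(1 : ℤ)⟧)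
    (hT : Triangle.mk (τ.tiltι.map S.f) (τ.tiltι.map S.g) δ ∈ distTriang _) :
    S.ShortExact :=
  have hf := AbelianSubcategory.isLimitKernelForkOfDistTriang τ.tilt_hom_shift_eq_zero S.f S.g δ hT
  have hg :=
    AbelianSubcategory.isColimitCokernelCoforkOfDistTriang τ.tilt_hom_shift_eq_zero S.f S.g δ hT
  { exact := ShortComplex.exact_of_f_is_kernel _ hf
    mono_f := ⟨fun _ _ h ↦ Fork.IsLimit.hom_ext hf h⟩
    epi_g := ⟨fun _ _ h ↦ Cofork.IsColimit.hom_ext hg h⟩ }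

/-- An epimorphism of the heart extends to a triangle with all vertices in the heart; its first
vertex is a kernel, hence is identified with `S.X₁`. -/
lemma exists_distTriang_of_tilt_shortExact {S : ShortComplex τ.Tilt} (hS : S.ShortExact) :
    ∃ δ : τ.tiltι.obj S.X₃ ⟶ (τ.tiltι.obj S.X₁)⟦(1 : ℤ)⟧,
      Triangle.mk (τ.tiltι.map S.f) (τ.tiltι.map S.g) δ ∈ distTriang _ := by
  have := hS.epi_g
  have := hS.mono_f
  obtain ⟨X₁, i, δ, hT⟩ := AbelianSubcategory.exists_distinguished_triangle_of_epi
    τ.boundedTStructure.heart_hom_shift_eq_zero τ.boundedTStructure.heart_admissibleMorphism S.g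
  let e : S.X₁ ≅ X₁ := hS.exact.fIsKernel.conePointUniqueUpToIso
    (AbelianSubcategory.isLimitKernelForkOfDistTriang
      τ.boundedTStructure.heart_hom_shift_eq_zero i S.g δ hT)
  have he : e.hom ≫ i = S.f :=
    IsLimit.conePointUniqueUpToIso_hom_comp _ _ WalkingParallelPair.zero
  have hT' := Bounded.ι.map_distinguished _
    (TStructure.distTriang_of_iso₁ hT (τ.boundedTStructure.heart.ι.mapIso e))
  rw [Functor.mapIso_hom, ← Functor.map_comp, he] at hT'
  exact ⟨_, hT'⟩

lemma shortExact_of_single_distTriang (S : ShortComplex C)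
    (δ : (singleFunctor C 0).obj S.X₃ ⟶ ((singleFunctor C 0).obj S.X₁)⟦(1 : ℤ)⟧)
    (hT : Triangle.mk ((singleFunctor C 0).map S.f) ((singleFunctor C 0).map S.g) δ ∈
      distTriang _) :
    S.ShortExact := by
  have h₁ := (isZero_of_isLE ((singleFunctor C 0).obj S.X₁) 0 1 (by lia))
  have h₃ := (isZero_of_isGE ((singleFunctor C 0).obj S.X₃) 0 (-1) (by lia))
  let e : S.map (singleFunctor C 0 ⋙ homologyFunctor C 0) ≅ S.map (𝟭 C) :=
    S.mapNatIso (singleFunctorCompHomologyFunctorIso C 0)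
  have hS : (S.map (singleFunctor C 0 ⋙ homologyFunctor C 0)).ShortExact :=
    { exact := HomologySequence.exact₂ _ hT 0
      mono_f := (HomologySequence.mono_homologyMap_mor₁_iff _ hT (-1) 0 (by lia)).2
        (h₃.eq_of_src _ _)
      epi_g := (HomologySequence.epi_homologyMap_mor₂_iff _ hT 0 1 (by lia)).2
        (h₁.eq_of_tgt _ _) }
  exact ShortComplex.shortExact_of_iso e hS

/-- Both sides say that the maps extend to a distinguished triangle of D(`C`) on objects in degree
0. -/
lemma shortExact_iff (S : ShortComplex τ.free.FullSubcategory) :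
    (S.map τ.free.ι).ShortExact ↔ (S.map τ.freeToTilt).ShortExact := by
  constructor
  · intro hS
    exact τ.tilt_shortExact_of_distTriang (S.map τ.freeToTilt) hS.singleδ
      hS.singleTriangle_distinguished
  · intro hS
    obtain ⟨δ, hT⟩ := τ.exists_distTriang_of_tilt_shortExact hS
    exact shortExact_of_single_distTriang (S.map τ.free.ι) δ hT

instance : τ.freeToTilt.Full where
  map_surjective f := by
    obtain ⟨g, hg⟩ := (singleFunctor C 0).map_surjective (τ.tiltι.map f)
    exact ⟨τ.free.homMk g, τ.tiltι.map_injective hg⟩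

instance : τ.freeToTilt.Faithful where
  map_injective h := τ.free.ι.map_injective ((singleFunctor C 0).map_injective
    (τ.tiltι.congr_map h))

lemma freeToTilt_essImage_of_isLE (Y : τ.Tilt) (hY : (τ.tiltι.obj Y).IsLE 0) :
    τ.freeToTilt.essImage Y := by
  obtain ⟨F, hF, ⟨e⟩⟩ := τ.exists_iso_single_of_ge (τ.tilt_ge Y) hY
  exact ⟨⟨F, hF⟩, ⟨τ.tiltι.preimageIso e.symm⟩⟩

lemma isLE_of_freeToTilt_essImage {Y : τ.Tilt} (hY : τ.freeToTilt.essImage Y) :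
    (τ.tiltι.obj Y).IsLE 0 := by
  obtain ⟨F, ⟨e⟩⟩ := hY
  have : (τ.tiltι.obj (τ.freeToTilt.obj F)).IsLE 0 :=
    inferInstanceAs (((singleFunctor C 0).obj F.obj).IsLE 0)
  exact TStructure.t.isLE_of_iso (τ.tiltι.mapIso e) 0

/-- Objects of `ℱ` are the objects of the tilt without cohomology in degree 1. In the triangle `X ⟶
Y ⟶ (kernel p)⟦1⟧` the outer terms live in degrees at most 0, the kernel being in degrees at most 1;
hence so does `Y`. -/
lemma freeToTilt_essImage_of_epi ⦃X Y : τ.Tilt⦄ (p : X ⟶ Y) [Epi p]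
    (hX : τ.freeToTilt.essImage X) : τ.freeToTilt.essImage Y := by
  let S := ShortComplex.mk (kernel.ι p) p (by simp)
  have hS : S.ShortExact :=
    { exact := ShortComplex.exact_of_f_is_kernel _ (kernelIsKernel p) }
  obtain ⟨δ, hT⟩ := τ.exists_distTriang_of_tilt_shortExact hS
  have := τ.isLE_of_freeToTilt_essImage hX
  have hK : (τ.tiltι.obj (kernel p)).IsLE 1 := τ.isLE_of_le (τ.tilt_le _)
  have hK' : ((τ.tiltι.obj (kernel p))⟦(1 : ℤ)⟧).IsLE 0 := TStructure.t.isLE_shift _ 1 1 0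
  exact τ.freeToTilt_essImage_of_isLE Y
    (TStructure.t.isLE₂ _ (rot_of_distTriang _ hT) 0 this hK')

variable {τ} in
-- Represent `X` by a complex ending in degree 1 and cover its last term by a torsion-free object.
lemma IsCotilting.exists_single_hom (hτ : τ.IsCotilting) (X : DerivedCategory C) [X.IsLE 1] :
    ∃ (B : C) (_ : τ.free B) (f : (singleFunctor C 1).obj B ⟶ X),
      Epi ((homologyFunctor C 1).map f) := by
  obtain ⟨K, _, ⟨e⟩⟩ := X.exists_iso_Q_obj_of_isLE 1
  obtain ⟨B, hB, p, _⟩ := hτ (K.X 1)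
  let φ : (HomologicalComplex.single C (.up ℤ) 1).obj B ⟶ K :=
    HomologicalComplex.mkHomFromSingle p (fun k hk ↦
      (K.isZero_of_isStrictlyLE 1 k (by simp at hk; lia)).eq_of_tgt _ _)
  have hφ : Epi (φ.f 1) := by
    dsimp [φ]
    rw [HomologicalComplex.mkHomFromSingle_f]
    infer_instance
  have := CochainComplex.epi_homologyMap_of_epi_of_single K φ hφ
  refine ⟨B, hB, Q.map φ ≫ e.inv, ?_⟩
  have : Epi ((homologyFunctor C 1).map (Q.map φ)) :=
    ((MorphismProperty.epimorphisms C).arrow_mk_iso_iff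
      (Arrow.isoOfNatIso (homologyFunctorFactors C 1) (Arrow.mk φ))).2 this
  have h : Epi ((homologyFunctor C 1).map (Q.map φ) ≫ (homologyFunctor C 1).map e.inv) :=
    epi_comp _ _
  rwa [← Functor.map_comp] at h

/-- If the torsion pair is cotilting, every object of the tilt embeds into a torsion-free object. -/
lemma exists_mono_freeToTilt (hτ : τ.IsCotilting) (Y : τ.Tilt) :
    ∃ (F : τ.free.FullSubcategory) (i : Y ⟶ τ.freeToTilt.obj F), Mono i := by
  have hY := τ.tilt_ge Y
  have : (τ.tiltι.obj Y).IsLE 1 := τ.isLE_of_le (τ.tilt_le Y)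
  have : (τ.tiltι.obj Y).IsGE 0 := τ.isGE_of_ge hY
  obtain ⟨B, hB, f, hf⟩ := hτ.exists_single_hom (τ.tiltι.obj Y)
  -- The cone `A` turns out to be a torsion-free object in degree 0, and the rotated triangle `Y ⟶ A
  -- ⟶ B` becomes a short exact sequence of the tilt.
  obtain ⟨A, g, h, hT⟩ := distinguished_cocone_triangle f
  let e : ((singleFunctor C 1).obj B)⟦(1 : ℤ)⟧ ≅ (singleFunctor C 0).obj B :=
    ((singleFunctors C).shiftIso 1 0 1 (by lia)).app B
  have hB₀ : (((singleFunctor C 1).obj B)⟦(1 : ℤ)⟧).IsLE 0 := TStructure.t.isLE_shift _ 1 1 0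
  have hB₂ : (((singleFunctor C 1).obj B)⟦(1 : ℤ)⟧).IsLE 1 := TStructure.t.isLE_of_le _ 0 1
  have hB₁ : (((singleFunctor C 1).obj B)⟦(1 : ℤ)⟧).IsGE 0 := TStructure.t.isGE_shift _ 1 1 0
  have hT' := rot_of_distTriang _ hT
  have hA₁ : A.IsGE 0 := TStructure.t.isGE₂ _ hT' 0 ‹_› hB₁
  have hA₂ : A.IsLE 1 := TStructure.t.isLE₂ _ hT' 1 ‹_› hB₂
  -- In degree 1, the map from the cohomology of `Y` to that of `A` is epi, and it is zero because
  -- `f` is already onto in that degree.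
  have hA₃ : A.IsLE 0 := by
    rw [isLE_iff]
    intro i hi
    obtain rfl | hi : i = 1 ∨ 1 < i := by lia
    · have h₁ : Epi ((homologyFunctor C 1).map g) :=
        (HomologySequence.epi_homologyMap_mor₂_iff _ hT 1 2 (by lia)).2
          ((isZero_of_isLE ((singleFunctor C 1).obj B) 1 2 (by lia)).eq_of_tgt _ _)
      have h₂ : (homologyFunctor C 1).map g = 0 := by
        rw [← cancel_epi ((homologyFunctor C 1).map f), comp_zero, ← Functor.map_comp]
        exact (congrArg _ (comp_distTriang_mor_zero₁₂ _ hT)).trans (Functor.map_zero _ _ _)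
      exact IsZero.of_epi_eq_zero _ h₂
    · exact isZero_of_isLE A 1 i hi
  -- H⁰(`A`) is an extension of a subobject of `B` by H⁰(`Y`), both torsion-free.
  have hA₄ : τ.free ((homologyFunctor C 0).obj A) := by
    have hz := isZero_of_isGE ((singleFunctor C 1).obj B) 1 0 (by lia)
    have h₁ : Mono ((homologyFunctor C 0).map g) :=
      (HomologySequence.mono_homologyMap_mor₂_iff _ hT 0).2 (hz.eq_of_src _ _)
    exact τ.free_of_shortExact (HomologySequence.exact₂ _ hT' 0) h₁ hY.2
      (τ.free.prop_of_iso ((homologyFunctor C 0).mapIso e ≪≫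
        (singleFunctorCompHomologyFunctorIso C 0).app B).symm hB)
  obtain ⟨F, hF, ⟨e'⟩⟩ := τ.exists_iso_single_of_ge (X := A)
    ⟨fun i hi ↦ isZero_of_isGE A 0 i hi, hA₄⟩ hA₃
  let u : A ≅ τ.tiltι.obj (τ.freeToTilt.obj ⟨F, hF⟩) := e'
  let t : ((singleFunctor C 1).obj B)⟦(1 : ℤ)⟧ ≅ τ.tiltι.obj (τ.freeToTilt.obj ⟨B, hB⟩) := e
  let i : Y ⟶ τ.freeToTilt.obj ⟨F, hF⟩ := τ.tiltι.preimage (g ≫ u.hom)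
  let q : τ.freeToTilt.obj ⟨F, hF⟩ ⟶ τ.freeToTilt.obj ⟨B, hB⟩ :=
    τ.tiltι.preimage (u.inv ≫ h ≫ t.hom)
  have hi : τ.tiltι.map i = g ≫ u.hom := τ.tiltι.map_preimage _
  have hq : τ.tiltι.map q = u.inv ≫ h ≫ t.hom := τ.tiltι.map_preimage _
  have hT'' : Triangle.mk (τ.tiltι.map i) (τ.tiltι.map q) (t.inv ≫ (-(f⟦(1 : ℤ)⟧'))) ∈
      distTriang _ := by
    refine isomorphic_distinguished _ hT' _
      (Triangle.isoMk _ _ (Iso.refl _) u.symm t.symm ?_ ?_ ?_)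
    · change τ.tiltι.map i ≫ u.inv = 𝟙 _ ≫ g
      rw [hi, Category.assoc, u.hom_inv_id, Category.comp_id, Category.id_comp]
    · change τ.tiltι.map q ≫ t.inv = u.inv ≫ h
      rw [hq, Category.assoc, Category.assoc, t.hom_inv_id, Category.comp_id]
    · change (t.inv ≫ (-(f⟦(1 : ℤ)⟧'))) ≫ (𝟙 _)⟦(1 : ℤ)⟧' = t.inv ≫ (-(f⟦(1 : ℤ)⟧'))
      rw [CategoryTheory.Functor.map_id, Category.comp_id]
  have w : i ≫ q = 0 := τ.tiltι.map_injective (by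
    rw [Functor.map_comp, Functor.map_zero]
    exact comp_distTriang_mor_zero₁₂ _ hT'')
  exact ⟨_, i, (τ.tilt_shortExact_of_distTriang (.mk i q w) _ hT'').mono_f⟩

end TorsionPair

/-! ### Dévissage and localization of homotopy categories. -/

section

open DerivedCategory

variable {A : Type*} [Category* A] [Abelian A] [HasDerivedCategory A]

lemma DerivedCategory.bounded_le_of_single (P : ObjectProperty (DerivedCategory A))
    [P.IsTriangulated] [P.IsClosedUnderIsomorphisms]
    (h : ∀ X : A, P ((singleFunctor A 0).obj X)) :
    (TStructure.t (C := A)).bounded ≤ P := by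
  have h_single (m : ℤ) (X : A) : P ((singleFunctor A m).obj X) := by
    have h₁ : P (((singleFunctor A m).obj X)⟦m⟧) :=
      P.prop_of_iso (((singleFunctors A).shiftIso m 0 m (by lia)).app X).symm (h X)
    exact P.prop_of_iso ((shiftEquiv (DerivedCategory A) m).unitIso.app _).symm
      (P.le_shift (-m) _ h₁)
  -- Induction on the number `n` of degrees in the interval from `a` to `a + n - 1`, which is empty
  -- for `n = 0`; each step splits off the top cohomology.
  have key (a : ℤ) (n : ℕ) : ∀ (X : DerivedCategory A), X.IsGE a → X.IsLE (a + n - 1) → P X := by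
    induction n with
    | zero =>
      intro X _ _
      exact P.prop_of_isZero (TStructure.t.isZero X (a + (0 : ℕ) - 1) a (by lia))
    | succ n hn =>
      intro X _ hX
      have hX' : X.IsLE (a + n) := by
        convert hX using 1
        push_cast
        ring
      have hT := TStructure.t.triangleLEGE_distinguished (a + n - 1) (a + n) (by lia) X
      have h₁ : ((TStructure.t.truncLE (a + n - 1)).obj X).IsGE a := inferInstance
      have h₁' : ((TStructure.t.truncLE (a + n - 1)).obj X).IsLE (a + n - 1) := inferInstance
      have h₂ : ((TStructure.t.truncGE (a + n)).obj X).IsLE (a + n) := inferInstance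
      obtain ⟨Y, ⟨e⟩⟩ := ((TStructure.t.truncGE (a + n)).obj
        X).exists_iso_singleFunctor_obj_of_isGE_of_isLE (a + n)
      exact P.ext_of_isTriangulatedClosed₂ _ hT (hn _ h₁ h₁')
        (P.prop_of_iso e.symm (h_single _ Y))
  rintro X ⟨⟨a, ha⟩, ⟨b, hb⟩⟩
  exact key a (b + 1 - a).toNat X ha (TStructure.t.isLE_of_le X b _ (by lia))

variable {E : Type*} [Category* E] [Preadditive E] (j : E ⥤ A) [j.Additive]

/-- The functor on cochain complexes induced by `j` followed by localization factors through the
homotopy category. -/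
noncomputable def CategoryTheory.Functor.mapHomologicalComplexCompQIso :
    j.mapHomologicalComplex (.up ℤ) ⋙ Q ≅
      HomotopyCategory.quotient E (.up ℤ) ⋙ j.mapHomotopyCategory (.up ℤ) ⋙ Qh :=
  isoWhiskerLeft _ (quotientCompQhIso A).symm ≪≫
    isoWhiskerRight (j.mapHomotopyCategoryFactors (.up ℤ)).symm Qh

/-- The image in the derived category of the complex `F` in degree `0`. -/
noncomputable def CategoryTheory.Functor.mapHomologicalComplexSingleIso [HasZeroObject E] (F : E) :
    Q.obj ((j.mapHomologicalComplex (.up ℤ)).obj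
      ((HomologicalComplex.single E (.up ℤ) 0).obj F)) ≅ (singleFunctor A 0).obj (j.obj F) :=
  Q.mapIso ((HomologicalComplex.singleMapHomologicalComplex j (.up ℤ) 0).app F)

variable [HasZeroObject E] [HasBinaryBiproducts E] [j.Full] [j.Faithful]

lemma CategoryTheory.Functor.isLocalization_mapHomotopyCategory_comp_Qh_of_left
    (hj : ∀ X : A, ∃ (F : E) (p : j.obj F ⟶ X), Epi p)
    (hj' : ∀ ⦃X Y : A⦄ (i : X ⟶ Y) [Mono i], j.essImage Y → j.essImage X) :
    (j.mapHomotopyCategory (.up ℤ) ⋙ Qh).IsLocalization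
      ((HomotopyCategory.subcategoryAcyclic A).inverseImage
        (j.mapHomotopyCategory (.up ℤ))).trW := by
  have := ObjectProperty.isVerdierLeftLocalizing_of_exists
    (j.mapHomotopyCategory (.up ℤ)).essImage (HomotopyCategory.subcategoryAcyclic A)
    (j.exists_left_resolution hj hj')
  have : (j.mapHomotopyCategory (.up ℤ) ⋙ Qh).EssSurj := ⟨fun Y ↦ by
    obtain ⟨Z, s, ⟨K, ⟨e⟩⟩, hs⟩ := j.exists_left_resolution hj hj' (Qh.objPreimage Y)
    have := Localization.inverts Qh (HomotopyCategory.subcategoryAcyclic A).trW s hs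
    exact ⟨K, ⟨Qh.mapIso e ≪≫ asIso (Qh.map s) ≪≫ Qh.objObjPreimageIso Y⟩⟩⟩
  exact Functor.isLocalization_comp_of_isLocalizedFullyFaithful _ _ _

lemma CategoryTheory.Functor.isLocalization_mapHomotopyCategory_comp_Qh_of_right
    (hj : ∀ X : A, ∃ (F : E) (i : X ⟶ j.obj F), Mono i)
    (hj' : ∀ ⦃X Y : A⦄ (p : X ⟶ Y) [Epi p], j.essImage X → j.essImage Y) :
    (j.mapHomotopyCategory (.up ℤ) ⋙ Qh).IsLocalization
      ((HomotopyCategory.subcategoryAcyclic A).inverseImage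
        (j.mapHomotopyCategory (.up ℤ))).trW := by
  have := ObjectProperty.isVerdierRightLocalizing_of_exists
    (j.mapHomotopyCategory (.up ℤ)).essImage (HomotopyCategory.subcategoryAcyclic A)
    (j.exists_right_resolution hj hj')
  have : (j.mapHomotopyCategory (.up ℤ) ⋙ Qh).EssSurj := ⟨fun Y ↦ by
    obtain ⟨Z, s, ⟨K, ⟨e⟩⟩, hs⟩ := j.exists_right_resolution hj hj' (Qh.objPreimage Y)
    have := Localization.inverts Qh (HomotopyCategory.subcategoryAcyclic A).trW s hs
    exact ⟨K, ⟨Qh.mapIso e ≪≫ (asIso (Qh.map s)).symm ≪≫ Qh.objObjPreimageIso Y⟩⟩⟩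
  exact Functor.isLocalization_comp_of_isLocalizedFullyFaithful _ _ _

end

/-! ### Equality of the two kernels and preservation of boundedness. -/

namespace TorsionPair

open DerivedCategory

variable {C : Type u} [Category.{v} C] [Abelian C] (τ : TorsionPair C)

lemma free_essImage_ι_of_mono ⦃X Y : C⦄ (i : X ⟶ Y) [Mono i] (hY : τ.free.ι.essImage Y) :
    τ.free.ι.essImage X := by
  obtain ⟨F, ⟨e⟩⟩ := hY
  exact ⟨⟨X, τ.free_of_mono i (τ.free.prop_of_iso e F.property)⟩, ⟨Iso.refl _⟩⟩

lemma exists_epi_free {τ : TorsionPair C} (hτ : τ.IsCotilting) (X : C) :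
    ∃ (F : τ.free.FullSubcategory) (p : τ.free.ι.obj F ⟶ X), Epi p := by
  obtain ⟨F, hF, p, hp⟩ := hτ X
  exact ⟨⟨F, hF⟩, p, hp⟩

variable [HasDerivedCategory.{w} C]

/-- A complex of torsion-free objects is acyclic in the tilt if and only if it is acyclic in `C`. -/
lemma inverseImage_subcategoryAcyclic_eq :
    (HomotopyCategory.subcategoryAcyclic τ.Tilt).inverseImage
      (τ.freeToTilt.mapHomotopyCategory (.up ℤ)) =
    (HomotopyCategory.subcategoryAcyclic C).inverseImage
      (τ.free.ι.mapHomotopyCategory (.up ℤ)) := by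
  ext K
  obtain ⟨K, rfl⟩ := HomotopyCategory.quotient_obj_surjective K
  have h₁ := HomotopyCategory.quotient_obj_mem_subcategoryAcyclic_iff_acyclic
    ((τ.freeToTilt.mapHomologicalComplex (.up ℤ)).obj K)
  have h₂ := HomotopyCategory.quotient_obj_mem_subcategoryAcyclic_iff_acyclic
    ((τ.free.ι.mapHomologicalComplex (.up ℤ)).obj K)
  refine h₁.trans (Iff.trans ⟨fun h ↦ ?_, fun h ↦ ?_⟩ h₂.symm)
  -- The image of a differential lies in `ℱ`: in the tilt as a quotient of its source, in `C` (next
  -- case) as a subobject of its target.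
  · exact Functor.acyclic_of_acyclic _ _
      (fun _ _ f ↦ τ.freeToTilt_essImage_of_epi (Abelian.factorThruImage _)
        (τ.freeToTilt.obj_mem_essImage _)) (fun S ↦ (τ.shortExact_iff S).2) K h
  · exact Functor.acyclic_of_acyclic _ _
      (fun _ _ f ↦ τ.free_essImage_ι_of_mono (Abelian.image.ι _)
        (τ.free.ι.obj_mem_essImage _)) (fun S ↦ (τ.shortExact_iff S).1) K h

variable {τ} [HasDerivedCategory.{w'} τ.Tilt]

/-- By dévissage it suffices to treat a single `Y`. It sits in a short exact sequence of the tilt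
whose other two terms are in `ℱ`, where `Φ` is known through `e`. -/
lemma bounded_functor_obj (hτ : τ.IsCotilting) (Φ : DerivedCategory τ.Tilt ⥤ DerivedCategory C) [Φ.CommShift ℤ]
    [Φ.IsTriangulated]
    (e : τ.freeToTilt.mapHomologicalComplex (.up ℤ) ⋙ Q ⋙ Φ ≅
      τ.free.ι.mapHomologicalComplex (.up ℤ) ⋙ Q) (X : DerivedCategory τ.Tilt)
    (hX : (TStructure.t (C := τ.Tilt)).bounded X) :
    (TStructure.t (C := C)).bounded (Φ.obj X) := by
  let P := (TStructure.t (C := C)).bounded.inverseImage Φ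
  have hP {Y : τ.Tilt} (hY : τ.freeToTilt.essImage Y) : P ((singleFunctor τ.Tilt 0).obj Y) := by
    obtain ⟨F, ⟨e'⟩⟩ := hY
    refine (TStructure.t (C := C)).bounded.prop_of_iso ?_ (bounded_single F.obj)
    exact (τ.free.ι.mapHomologicalComplexSingleIso F).symm ≪≫ (e.app _).symm ≪≫
      Φ.mapIso (τ.freeToTilt.mapHomologicalComplexSingleIso F ≪≫ (singleFunctor _ 0).mapIso e')
  refine bounded_le_of_single P (fun Y ↦ ?_) X hX
  obtain ⟨F, i, _⟩ := τ.exists_mono_freeToTilt hτ Y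
  let S := ShortComplex.mk i (cokernel.π i) (by simp)
  have hS : S.ShortExact :=
    { exact := ShortComplex.exact_of_g_is_cokernel _ (cokernelIsCokernel i) }
  exact P.ext_of_isTriangulatedClosed₁ _ hS.singleTriangle_distinguished
    (hP (τ.freeToTilt.obj_mem_essImage F))
    (hP (τ.freeToTilt_essImage_of_epi (cokernel.π i) (τ.freeToTilt.obj_mem_essImage F)))

/-- Dual dévissage: an object of `C` is the cokernel of a monomorphism between objects of `ℱ`. -/
lemma bounded_inverse_obj (hτ : τ.IsCotilting) (Ψ : DerivedCategory C ⥤ DerivedCategory τ.Tilt) [Ψ.CommShift ℤ]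
    [Ψ.IsTriangulated]
    (e : τ.free.ι.mapHomologicalComplex (.up ℤ) ⋙ Q ⋙ Ψ ≅
      τ.freeToTilt.mapHomologicalComplex (.up ℤ) ⋙ Q) (X : DerivedCategory C)
    (hX : (TStructure.t (C := C)).bounded X) :
    (TStructure.t (C := τ.Tilt)).bounded (Ψ.obj X) := by
  let P := (TStructure.t (C := τ.Tilt)).bounded.inverseImage Ψ
  have hP {Y : C} (hY : τ.free.ι.essImage Y) : P ((singleFunctor C 0).obj Y) := by
    obtain ⟨F, ⟨e'⟩⟩ := hY
    have hF : (TStructure.t (C := τ.Tilt)).bounded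
        ((singleFunctor τ.Tilt 0).obj (τ.freeToTilt.obj F)) :=
      ⟨⟨0, inferInstance⟩, ⟨0, inferInstance⟩⟩
    refine (TStructure.t (C := τ.Tilt)).bounded.prop_of_iso ?_ hF
    exact (τ.freeToTilt.mapHomologicalComplexSingleIso F).symm ≪≫ (e.app _).symm ≪≫
      Ψ.mapIso (τ.free.ι.mapHomologicalComplexSingleIso F ≪≫ (singleFunctor _ 0).mapIso e')
  refine bounded_le_of_single P (fun Y ↦ ?_) X hX
  obtain ⟨F, p, _⟩ := exists_epi_free hτ Y
  let S := ShortComplex.mk (kernel.ι p) p (by simp)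
  have hS : S.ShortExact :=
    { exact := ShortComplex.exact_of_f_is_kernel _ (kernelIsKernel p) }
  exact P.ext_of_isTriangulatedClosed₃ _ hS.singleTriangle_distinguished
    (hP (τ.free_essImage_ι_of_mono (kernel.ι p) (τ.free.ι.obj_mem_essImage F)))
    (hP (τ.free.ι.obj_mem_essImage F))

end TorsionPair

theorem mainTheorem11 {C : Type u} [Category.{v} C] [Abelian C] [HasDerivedCategory.{w} C]
    (τ : TorsionPair C) [HasDerivedCategory.{w'} τ.Tilt] (hτ : τ.IsCotilting) :
    ∃ (Φ : DerivedCategory τ.Tilt ≌ DerivedCategory C)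
      (_ : Φ.functor.CommShift ℤ)
      (Φb : DerivedCategory.Bounded τ.Tilt ≌ DerivedCategory.Bounded C)
      (_ : Φb.functor.CommShift ℤ),
      Φ.functor.IsTriangulated ∧ Φb.functor.IsTriangulated ∧
      Nonempty (Φb.functor ⋙ DerivedCategory.Bounded.ι ≅
        DerivedCategory.Bounded.ι ⋙ Φ.functor) ∧
      Nonempty (τ.freeToTilt.mapHomologicalComplex (ComplexShape.up ℤ) ⋙
          DerivedCategory.Q ⋙ Φ.functor ≅
        τ.free.ι.mapHomologicalComplex (ComplexShape.up ℤ) ⋙ DerivedCategory.Q) := by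
  have h₁ := τ.freeToTilt.isLocalization_mapHomotopyCategory_comp_Qh_of_right
    (τ.exists_mono_freeToTilt hτ) τ.freeToTilt_essImage_of_epi
  have h₂ := τ.free.ι.isLocalization_mapHomotopyCategory_comp_Qh_of_left
    (TorsionPair.exists_epi_free hτ) τ.free_essImage_ι_of_mono
  -- From here both functors out of K(`ℱ`) are localizations at the same class of morphisms.
  rw [τ.inverseImage_subcategoryAcyclic_eq] at h₁
  obtain ⟨Φ, _, _, hΦ, hΦ', ⟨e⟩, ⟨e'⟩⟩ := Localization.exists_triangulated_equivalence
    ((HomotopyCategory.subcategoryAcyclic C).inverseImage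
      (τ.free.ι.mapHomotopyCategory (.up ℤ)))
    (τ.freeToTilt.mapHomotopyCategory (.up ℤ) ⋙ DerivedCategory.Qh)
    (τ.free.ι.mapHomotopyCategory (.up ℤ) ⋙ DerivedCategory.Qh)
  let u : τ.freeToTilt.mapHomologicalComplex (.up ℤ) ⋙ DerivedCategory.Q ⋙ Φ.functor ≅
      τ.free.ι.mapHomologicalComplex (.up ℤ) ⋙ DerivedCategory.Q :=
    Functor.isoWhiskerRight τ.freeToTilt.mapHomologicalComplexCompQIso Φ.functor ≪≫
      Functor.isoWhiskerLeft (HomotopyCategory.quotient _ (.up ℤ)) e ≪≫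
      τ.free.ι.mapHomologicalComplexCompQIso.symm
  let u' : τ.free.ι.mapHomologicalComplex (.up ℤ) ⋙ DerivedCategory.Q ⋙ Φ.inverse ≅
      τ.freeToTilt.mapHomologicalComplex (.up ℤ) ⋙ DerivedCategory.Q :=
    Functor.isoWhiskerRight τ.free.ι.mapHomologicalComplexCompQIso Φ.inverse ≪≫
      Functor.isoWhiskerLeft (HomotopyCategory.quotient _ (.up ℤ)) e' ≪≫
      τ.freeToTilt.mapHomologicalComplexCompQIso.symm
  obtain ⟨Φb, hc, hb, hi⟩ := Φ.exists_triangulated_restriction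
    (DerivedCategory.TStructure.t (C := τ.Tilt)).bounded
    (DerivedCategory.TStructure.t (C := C)).bounded
    (TorsionPair.bounded_functor_obj hτ Φ.functor u)
    (TorsionPair.bounded_inverse_obj hτ Φ.inverse u')
  exact ⟨Φ, inferInstance, Φb, hc, hΦ, hb, hi, ⟨u⟩⟩
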